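/- Let $M$ be a Hausdorff $C^\infty$ manifold of dimension $n$ (without boundary), let $\Omega^a(M)$ denote the smooth real $a$-forms on $M$, and let $\mathfrak h=\bigoplus_{a=0}^{n}\Omega^a(M)$, where an $a$-form is given the degree $a'=-a-1$. Let $\phi$ be a smooth $1$-form on $M$ that is not identically zero, let $t\neq 0$ be a real number, and let $F$ be a real-valued function of pairs of non-negative integers. For $\alpha\in\Omega^a(M)$ and $\beta\in\Omega^b(M)$ put $$[\alpha,\beta]=(-1)^a d(\alpha\wedge\beta)+F(a,b)\,\alpha\wedge t\phi\wedge\beta\in\Omega^{a+b+1}(M).$$ Only the values $F(a,b)$ with $a+b\le n-1$ matter, since $\alpha\wedge\phi\wedge\beta=0$ otherwise. Consider the two conditions * super-symmetry: $[\alpha,\beta]+(-1)^{a'b'}[\beta,\alpha]=0$ for all $a,b\ge 0$, $\alpha\in\Omega^a(M)$, $\beta\in\Omega^b(M)$; * super Jacobi identity: $(-1)^{a'c'}[[\alpha,\beta],\gamma]+(-1)^{b'a'}[[\beta,\gamma],\alpha]+(-1)^{c'b'}[[\gamma,\alpha],\beta]=0$ for all $a,b,c\ge 0$, $\alpha\in\Omega^a(M)$,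 $\beta\in\Omega^b(M)$, $\gamma\in\Omega^c(M)$. Then: 1. If the bracket is super-symmetric, then $F(a,b)=F(b,a)$ for all $a,b\ge 0$ with $a+b\le n-1$. 2. If the bracket is super-symmetric and satisfies the super Jacobi identity, and $\phi$ is not closed, then $F(a,b)=0$ for all $a,b\ge 0$ with $a+b\le n-1$. 3. If the bracket is super-symmetric and satisfies the super Jacobi identity, and $\phi$ is closed, then there is a constant $\kappa\in\mathbb R$ such that $F(a,b)=\kappa(a+b+2)$ for all $a,b\ge 0$ with $a+b\le n-1$. -/

import Mathlib

open scoped Manifold ContDiff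

noncomputable section

namespace DiffForm

/-- Exterior product of alternating forms on a topological vector space, in the shuffle
normalization: `(f ∧ g)(v) = ∑ sgn(σ) f(v_σ(1), …, v_σ(a)) g(v_σ(a+1), …, v_σ(a+b))`, the sum being
over the `(a, b)`-shuffles `σ` (this is `AlternatingMap.domCoprod`, multiplied out in `ℝ`). -/
def wedge {V : Type*} [AddCommGroup V] [Module ℝ V] [TopologicalSpace V] {a b : ℕ}
    (f : V [⋀^Fin a]→L[ℝ] ℝ) (g : V [⋀^Fin b]→L[ℝ] ℝ) : V [⋀^Fin (a + b)]→L[ℝ] ℝ :=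
  { ((LinearMap.mul' ℝ ℝ).compAlternatingMap
      (f.toAlternatingMap.domCoprod g.toAlternatingMap)).domDomCongr finSumFinEquiv with
    cont := by
      have h : ∀ σ : Equiv.Perm.ModSumCongr (Fin a) (Fin b), Continuous fun v : Fin (a + b) → V =>
          LinearMap.mul' ℝ ℝ (AlternatingMap.domCoprod.summand f.toAlternatingMap
            g.toAlternatingMap σ (fun i => v (finSumFinEquiv i))) := by
        intro σ
        induction σ using Quotient.inductionOn' with | _ σ
        have hf : Continuous fun v : Fin (a + b) → V =>
            f (fun i => v (finSumFinEquiv (σ (Sum.inl i)))) :=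
          f.cont.comp (continuous_pi fun i => continuous_apply _)
        have hg : Continuous fun v : Fin (a + b) → V =>
            g (fun i => v (finSumFinEquiv (σ (Sum.inr i)))) :=
          g.cont.comp (continuous_pi fun i => continuous_apply _)
        have key : ∀ v : Fin (a + b) → V,
            LinearMap.mul' ℝ ℝ (AlternatingMap.domCoprod.summand f.toAlternatingMap
              g.toAlternatingMap (Quotient.mk'' σ) (fun i => v (finSumFinEquiv i)))
            = ((Equiv.Perm.sign σ : ℤ) : ℝ) * (f (fun i => v (finSumFinEquiv (σ (Sum.inl i))))
                * g (fun i => v (finSumFinEquiv (σ (Sum.inr i))))) := by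
          intro v
          rw [AlternatingMap.domCoprod.summand_mk'', _root_.smul_apply, Units.smul_def, map_zsmul,
            zsmul_eq_mul]
          rfl
        exact (continuous_const.mul (hf.mul hg)).congr fun v => (key v).symm
      have h' := continuous_finsetSum Finset.univ fun σ _ => h σ
      refine h'.congr fun v => ?_
      rw [← map_sum, ← _root_.sum_apply]
      rfl }

end DiffForm

/-- Fields of alternating `k`-forms on the `n`-manifold `M` (smoothness is `DForm.IsSmooth`). -/
abbrev DForm (n : ℕ) (M : Type*) [TopologicalSpace M] [ChartedSpace (EuclideanSpace ℝ (Fin n)) M]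
    (k : ℕ) : Type _ :=
  (x : M) → TangentSpace (𝓡 n) x [⋀^Fin k]→L[ℝ] ℝ

namespace DForm

variable {n : ℕ} {M : Type*} [TopologicalSpace M] [ChartedSpace (EuclideanSpace ℝ (Fin n)) M]

/-- The expression of `η` in the chart around `x₀`, i.e. the pullback of `η` under the inverse of
that chart; it is meaningful on the target of the chart, an open subset of `ℝⁿ`. -/
def inChart {k : ℕ} (η : DForm n M k) (x₀ : M) (y : EuclideanSpace ℝ (Fin n)) :
    EuclideanSpace ℝ (Fin n) [⋀^Fin k]→L[ℝ] ℝ :=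
  (η ((extChartAt (𝓡 n) x₀).symm y)).compContinuousLinearMap
    (mfderiv (𝓡 n) (𝓡 n) (extChartAt (𝓡 n) x₀).symm y)

/-- `η` is a smooth differential form: its expressions in charts covering `M` are `C^∞`. -/
def IsSmooth {k : ℕ} (η : DForm n M k) : Prop :=
  ∀ x₀ : M, ContDiffOn ℝ ∞ (η.inChart x₀) (extChartAt (𝓡 n) x₀).target

/-- Exterior derivative: at `x` it is the exterior derivative on `ℝⁿ` of the expression of `η` in
the chart around `x`, pulled back by the differential of that chart at `x`. -/
def d {k : ℕ} (η : DForm n M k) : DForm n M (k + 1) := fun x =>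
  (extDeriv (η.inChart x) (extChartAt (𝓡 n) x x)).compContinuousLinearMap
    (mfderiv (𝓡 n) (𝓡 n) (extChartAt (𝓡 n) x) x)

/-- A form is closed (a cocycle) if its exterior derivative vanishes. -/
def IsClosed {k : ℕ} (η : DForm n M k) : Prop := η.d = 0

/-- Pointwise exterior product of forms. -/
def wedge {a b : ℕ} (α : DForm n M a) (β : DForm n M b) : DForm n M (a + b) := fun x =>
  DiffForm.wedge (α x) (β x)

/-- Transport of a form along an equality of degrees. -/
def cast {k l : ℕ} (h : k = l) (η : DForm n M k) : DForm n M l := h ▸ η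

/-- The deformed bracket `(-1)^a d(α ∧ β) + F(a,b) α ∧ tφ ∧ β` of an `a`-form and a `b`-form. -/
def bracket (F : ℕ → ℕ → ℝ) (t : ℝ) (φ : DForm n M 1) {a b : ℕ}
    (α : DForm n M a) (β : DForm n M b) : DForm n M (a + b + 1) :=
  (-1 : ℝ) ^ a • (α.wedge β).d
    + F a b • ((α.wedge (t • φ)).wedge β).cast (Nat.add_right_comm a 1 b)

/-- Super-symmetry `[α, β] + (-1)^{a'b'} [β, α] = 0` of the bracket on smooth forms; an `a`-form has
grading `a' = -a - 1`, which has the parity of `a + 1`. -/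
def SuperSymmetric (F : ℕ → ℕ → ℝ) (t : ℝ) (φ : DForm n M 1) : Prop :=
  ∀ (a b : ℕ) (α : DForm n M a) (β : DForm n M b), α.IsSmooth → β.IsSmooth →
    bracket F t φ α β
      + (-1 : ℝ) ^ ((a + 1) * (b + 1)) •
          (bracket F t φ β α).cast (show b + a + 1 = a + b + 1 by omega) = 0

/-- Super Jacobi identity of the bracket on smooth forms: the sum of `(-1)^{a'c'} [[α, β], γ]` over
the cyclic permutations of `α, β, γ` vanishes. -/
def SuperJacobi (F : ℕ → ℕ → ℝ) (t : ℝ) (φ : DForm n M 1) : Prop :=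
  ∀ (a b c : ℕ) (α : DForm n M a) (β : DForm n M b) (γ : DForm n M c),
    α.IsSmooth → β.IsSmooth → γ.IsSmooth →
    (-1 : ℝ) ^ ((a + 1) * (c + 1)) •
        (bracket F t φ (bracket F t φ α β) γ).cast
          (show a + b + 1 + c + 1 = a + b + c + 2 by omega)
      + (-1 : ℝ) ^ ((b + 1) * (a + 1)) •
        (bracket F t φ (bracket F t φ β γ) α).cast
          (show b + c + 1 + a + 1 = a + b + c + 2 by omega)
      + (-1 : ℝ) ^ ((c + 1) * (b + 1)) •
        (bracket F t φ (bracket F t φ γ α) β).cast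
          (show c + a + 1 + b + 1 = a + b + c + 2 by omega) = 0

end DForm

end

/-!
Testing the two identities on a few forms turns them into equations for `F`.

*Local form.* `DForm.inChart_d` (naturality of the exterior derivative under changes of charts) and
`DForm.inChart_wedge` allow the bracket to be computed in one fixed chart around a point `q`. Bump
functions (`DForm.exists_isSmooth_inChart_eventuallyEq`) realize every form `u • A` on `ℝⁿ`, with
`u` a smooth function and `A` constant, as the germ at `q` of a smooth form on `M`. Constant forms
are written as elements of the exterior algebra of the dual space by means of `DiffForm.toForm`,
under which exterior products become products (`DiffForm.wedge_toForm`) and the differential of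
`u • x` becomes `du * x`. All signs are then computed in the exterior algebra.

*Symmetry.* On forms constant near `q`, super-symmetry reads `(F(a,b) - F(b,a)) x ∧ φ ∧ z = 0`. If
`φ` does not vanish at `q` and `a + b + 1 ≤ n`, then `x` and `z` can be chosen so that the product
is nonzero.

*Recurrence.* Where `φ` does not vanish, the Jacobi identity for `1`, `u x` and `z`, with `x`, `z`
constant and `u` a coordinate function vanishing at `q`, gives
`F(0,b) - F(b+1,c) + F(b,c) - F(b+c+1,0) + F(c,0) = 0` for `b + c + 2 ≤ n`
(`DForm.SuperJacobi.recurrence`). Together with symmetry it forces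
`F(a,b) = F(0,0)/2 * (a + b + 2)`, for closed and for non-closed `φ` alike.

*Non-closed `φ`.* The Jacobi identity for `1, 1, 1` is `3 F(0,0) t dφ = 0`, so that `F(0,0) = 0` and
hence `F` vanishes (`DForm.SuperJacobi.apply_zero_zero`).
-/

open scoped Manifold ContDiff

open Filter Topology

noncomputable section

namespace DiffForm

variable {V : Type*} [NormedAddCommGroup V] [NormedSpace ℝ V]

/-! ### Forms from the exterior algebra of the dual space -/

/-- The decomposable form `e₀ ∧ ⋯ ∧ e_{k-1}`, i.e. `v ↦ det (eᵢ (vⱼ))`. -/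
def detForm {k : ℕ} (e : Fin k → V →L[ℝ] ℝ) : V [⋀^Fin k]→L[ℝ] ℝ :=
  { Matrix.detRowAlternating.compLinearMap
      (LinearMap.pi fun i => ((e i : V →L[ℝ] ℝ) : V →ₗ[ℝ] ℝ)) with
    cont := by
      change Continuous fun v : Fin k → V => (Matrix.of fun j i => e i (v j)).det
      refine Continuous.matrix_det ?_
      exact continuous_pi fun j => continuous_pi fun i =>
        (e i).continuous.comp (continuous_apply j) }

theorem detForm_apply {k : ℕ} (e : Fin k → V →L[ℝ] ℝ) (v : Fin k → V) :
    detForm e v = (Matrix.of fun i j => e i (v j)).det := by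
  rw [← Matrix.det_transpose]
  rfl

theorem detForm_update {k : ℕ} (e : Fin k → V →L[ℝ] ℝ) (i : Fin k) (z : V →L[ℝ] ℝ)
    (v : Fin k → V) :
    detForm (Function.update e i z) v =
      ((Matrix.of fun a j => e a (v j)).updateRow i fun j => z (v j)).det := by
  rw [detForm_apply]
  congr 1
  ext a j
  by_cases ha : a = i
  · subst ha; simp
  · simp [ha]

/-- `detForm` as an alternating function of the covectors. -/
def detFormAlternating (k : ℕ) :
    (V →L[ℝ] ℝ) [⋀^Fin k]→ₗ[ℝ] (V [⋀^Fin k]→L[ℝ] ℝ) where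
  toFun := detForm
  map_update_add' {inst} e i x y := by
    obtain rfl : inst = instDecidableEqFin k := Subsingleton.elim _ _
    ext v
    rw [ContinuousAlternatingMap.add_apply, detForm_update, detForm_update, detForm_update]
    exact Matrix.det_updateRow_add _ i (fun j => x (v j)) (fun j => y (v j))
  map_update_smul' {inst} e i c x := by
    obtain rfl : inst = instDecidableEqFin k := Subsingleton.elim _ _
    ext v
    rw [ContinuousAlternatingMap.smul_apply, detForm_update, detForm_update]
    exact Matrix.det_updateRow_smul _ i c (fun j => x (v j))
  map_eq_zero_of_eq' e i j hij hne := by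
    ext v
    rw [detForm_apply]
    exact Matrix.det_zero_of_row_eq hne (funext fun a => by simp [hij])

/-- The alternating `k`-form defined by an element of the exterior algebra of the dual space;
components in degrees other than `k` are sent to zero. -/
def toForm (k : ℕ) : ExteriorAlgebra ℝ (V →L[ℝ] ℝ) →ₗ[ℝ] (V [⋀^Fin k]→L[ℝ] ℝ) :=
  ExteriorAlgebra.liftAlternating fun i =>
    if h : i = k then h ▸ detFormAlternating i else 0

theorem toForm_ιMulti {k : ℕ} (e : Fin k → V →L[ℝ] ℝ) :
    toForm k (ExteriorAlgebra.ιMulti ℝ k e) = detForm e := by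
  rw [toForm, ExteriorAlgebra.liftAlternating_apply_ιMulti, dif_pos rfl]
  rfl

theorem toForm_ι (e : V →L[ℝ] ℝ) (v : Fin 1 → V) :
    toForm 1 (ExteriorAlgebra.ι ℝ e) v = e (v 0) := by
  have : ExteriorAlgebra.ι ℝ e = ExteriorAlgebra.ιMulti ℝ 1 ![e] := by
    simp [ExteriorAlgebra.ιMulti_succ_apply]
  rw [this, toForm_ιMulti, detForm_apply]
  simp

/-! ### Exterior products of alternating forms -/

theorem wedge_apply {a b : ℕ} (f : V [⋀^Fin a]→L[ℝ] ℝ) (g : V [⋀^Fin b]→L[ℝ] ℝ)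
    (v : Fin (a + b) → V) :
    wedge f g v = LinearMap.mul' ℝ ℝ ((f.toAlternatingMap.domCoprod g.toAlternatingMap)
      fun i => v (finSumFinEquiv i)) := rfl

theorem wedge_add_left {a b : ℕ} (f f' : V [⋀^Fin a]→L[ℝ] ℝ) (g : V [⋀^Fin b]→L[ℝ] ℝ) :
    wedge (f + f') g = wedge f g + wedge f' g := by
  ext v
  rw [ContinuousAlternatingMap.add_apply]
  simp only [wedge_apply, ContinuousAlternatingMap.toAlternatingMap_add,
    ← AlternatingMap.domCoprod'_apply, TensorProduct.add_tmul, map_add, AlternatingMap.add_apply]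

theorem wedge_add_right {a b : ℕ} (f : V [⋀^Fin a]→L[ℝ] ℝ) (g g' : V [⋀^Fin b]→L[ℝ] ℝ) :
    wedge f (g + g') = wedge f g + wedge f g' := by
  ext v
  rw [ContinuousAlternatingMap.add_apply]
  simp only [wedge_apply, ContinuousAlternatingMap.toAlternatingMap_add,
    ← AlternatingMap.domCoprod'_apply, TensorProduct.tmul_add, map_add, AlternatingMap.add_apply]

theorem wedge_smul_left {a b : ℕ} (r : ℝ) (f : V [⋀^Fin a]→L[ℝ] ℝ) (g : V [⋀^Fin b]→L[ℝ] ℝ) :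
    wedge (r • f) g = r • wedge f g := by
  ext v
  rw [ContinuousAlternatingMap.smul_apply]
  simp only [wedge_apply, ContinuousAlternatingMap.toAlternatingMap_smul,
    ← AlternatingMap.domCoprod'_apply, ← TensorProduct.smul_tmul', map_smul,
    AlternatingMap.smul_apply]

theorem wedge_smul_right {a b : ℕ} (r : ℝ) (f : V [⋀^Fin a]→L[ℝ] ℝ) (g : V [⋀^Fin b]→L[ℝ] ℝ) :
    wedge f (r • g) = r • wedge f g := by
  ext v
  rw [ContinuousAlternatingMap.smul_apply]
  simp only [wedge_apply, ContinuousAlternatingMap.toAlternatingMap_smul,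
    ← AlternatingMap.domCoprod'_apply, TensorProduct.tmul_smul, map_smul,
    AlternatingMap.smul_apply]

theorem wedge_compContinuousLinearMap {V W : Type*} [AddCommGroup V] [Module ℝ V]
    [TopologicalSpace V] [AddCommGroup W] [Module ℝ W] [TopologicalSpace W] {a b : ℕ}
    (f : V [⋀^Fin a]→L[ℝ] ℝ) (g : V [⋀^Fin b]→L[ℝ] ℝ) (A : W →L[ℝ] V) :
    (wedge f g).compContinuousLinearMap A =
      wedge (f.compContinuousLinearMap A) (g.compContinuousLinearMap A) := by
  ext v
  change LinearMap.mul' ℝ ℝ ((f.toAlternatingMap.domCoprod g.toAlternatingMap)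
      fun i => A (v (finSumFinEquiv i))) = LinearMap.mul' ℝ ℝ
      (((f.compContinuousLinearMap A).toAlternatingMap.domCoprod
        (g.compContinuousLinearMap A).toAlternatingMap) fun i => v (finSumFinEquiv i))
  congr 1
  rw [AlternatingMap.domCoprod_apply, AlternatingMap.domCoprod_apply, _root_.sum_apply,
    _root_.sum_apply]
  refine Finset.sum_congr rfl fun σ _ => ?_
  induction σ using Quotient.inductionOn' with | _ σ
  rw [AlternatingMap.domCoprod.summand_mk'', AlternatingMap.domCoprod.summand_mk'']
  rfl

/-- The Leibniz formula: `detForm e` is the alternatization of `v ↦ ∏ eᵢ (vᵢ)`. This brings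
`MultilinearMap.domCoprod_alternization` to bear on exterior products. -/
theorem detForm_eq_alternatization {k : ℕ} (e : Fin k → V →L[ℝ] ℝ) :
    (detForm e).toAlternatingMap = MultilinearMap.alternatization
      ((MultilinearMap.mkPiAlgebra ℝ (Fin k) ℝ).compLinearMap
        fun i => ((e i : V →L[ℝ] ℝ) : V →ₗ[ℝ] ℝ)) := by
  ext v
  rw [MultilinearMap.alternatization_apply]
  change detForm e v = _
  rw [detForm_apply, ← Matrix.det_transpose, Matrix.det_apply]
  rfl

theorem wedge_detForm {a b : ℕ} (e : Fin a → V →L[ℝ] ℝ) (f : Fin b → V →L[ℝ] ℝ) :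
    wedge (detForm e) (detForm f) = detForm (Fin.append e f) := by
  ext v
  rw [wedge_apply, detForm_eq_alternatization, detForm_eq_alternatization,
    ← MultilinearMap.domCoprod_alternization, MultilinearMap.alternatization_apply,
    detForm_apply, ← Matrix.det_transpose, Matrix.det_apply, map_sum]
  refine Fintype.sum_equiv finSumFinEquiv.permCongr _ _ fun σ => ?_
  rw [Equiv.Perm.sign_permCongr, Units.smul_def, Units.smul_def, map_zsmul]
  congr 1
  simp only [Matrix.transpose_apply, Matrix.of_apply]
  rw [← Equiv.prod_comp finSumFinEquiv, Fintype.prod_sum_type]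
  simp [Fin.append_left, Fin.append_right]

/-- Exterior products are products in the exterior algebra of the dual. Homogeneity is needed, since
`toForm k` discards the components of degree other than `k`. -/
theorem wedge_toForm {a b : ℕ} {x y : ExteriorAlgebra ℝ (V →L[ℝ] ℝ)}
    (hx : x ∈ ⋀[ℝ]^a (V →L[ℝ] ℝ)) (hy : y ∈ ⋀[ℝ]^b (V →L[ℝ] ℝ)) :
    wedge (toForm a x) (toForm b y) = toForm (a + b) (x * y) := by
  rw [← exteriorPower.ιMulti_span_fixedDegree] at hx hy
  induction hx using Submodule.span_induction with
  | mem x hx =>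
    obtain ⟨e, rfl⟩ := hx
    induction hy using Submodule.span_induction with
    | mem y hy =>
      obtain ⟨f, rfl⟩ := hy
      rw [ExteriorAlgebra.ιMulti_mul_ιMulti]
      simp only [toForm_ιMulti, wedge_detForm]
    | zero =>
      simpa using wedge_smul_right (0 : ℝ) (toForm a (ExteriorAlgebra.ιMulti ℝ a e))
        (0 : V [⋀^Fin b]→L[ℝ] ℝ)
    | add y y' _ _ h h' => simp only [map_add, mul_add, wedge_add_right, h, h']
    | smul r y _ h => simp only [map_smul, mul_smul_comm, wedge_smul_right, h]
  | zero => simpa using wedge_smul_left (0 : ℝ) (0 : V [⋀^Fin a]→L[ℝ] ℝ) (toForm b y)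
  | add x x' _ _ h h' => simp only [map_add, add_mul, wedge_add_left, h, h']
  | smul r x _ h => simp only [map_smul, smul_mul_assoc, wedge_smul_left, h]

/-- The alternatization occurring in `extDeriv` turns `l ⊗ x` into `l ∧ x`; on decomposable forms
this is the Laplace expansion along the first row. -/
theorem alternatizeUncurryFin_smulRight_toForm {k : ℕ} (l : V →L[ℝ] ℝ)
    {x : ExteriorAlgebra ℝ (V →L[ℝ] ℝ)} (hx : x ∈ ⋀[ℝ]^k (V →L[ℝ] ℝ)) :
    ContinuousAlternatingMap.alternatizeUncurryFin (l.smulRight (toForm k x)) =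
      toForm (k + 1) (ExteriorAlgebra.ι ℝ l * x) := by
  rw [← exteriorPower.ιMulti_span_fixedDegree] at hx
  induction hx using Submodule.span_induction with
  | mem x hx =>
    obtain ⟨e, rfl⟩ := hx
    have : ExteriorAlgebra.ι ℝ l * ExteriorAlgebra.ιMulti ℝ k e
        = ExteriorAlgebra.ιMulti ℝ (k + 1) (Fin.cons l e) := by
      rw [ExteriorAlgebra.ιMulti_succ_apply]; simp [Matrix.vecTail, Function.comp_def]
    rw [this, toForm_ιMulti, toForm_ιMulti]
    ext v
    rw [ContinuousAlternatingMap.alternatizeUncurryFin_apply, detForm_apply,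
      Matrix.det_succ_row_zero]
    refine Finset.sum_congr rfl fun i _ => ?_
    rw [ContinuousLinearMap.smulRight_apply, ContinuousAlternatingMap.smul_apply, detForm_apply]
    simp [Fin.removeNth, Matrix.submatrix, mul_assoc]
  | zero => ext v; simp [ContinuousAlternatingMap.alternatizeUncurryFin_apply]
  | add x y _ _ h h' =>
    rw [mul_add, map_add, map_add, ← h, ← h', ← ContinuousAlternatingMap.alternatizeUncurryFin_add]
    congr 1
    ext v w
    simp
  | smul r y _ h =>
    rw [mul_smul_comm, map_smul, map_smul, ← h,
      ← ContinuousAlternatingMap.alternatizeUncurryFin_smul]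
    congr 1
    ext v w
    simp [mul_left_comm]

/-! ### Graded commutativity in the exterior algebra -/

theorem mul_ι_of_mem {M : Type*} [AddCommGroup M] [Module ℝ M] {a : ℕ} {x : ExteriorAlgebra ℝ M}
    (hx : x ∈ ⋀[ℝ]^a M) (m : M) :
    x * ExteriorAlgebra.ι ℝ m = (-1 : ℝ) ^ a • (ExteriorAlgebra.ι ℝ m * x) := by
  change x ∈ LinearMap.range (ExteriorAlgebra.ι ℝ) ^ a at hx
  induction hx using Submodule.pow_induction_on_left' with
  | algebraMap r => simp [Algebra.commutes]
  | add x y i _ _ h h' => rw [add_mul, h, h', mul_add, smul_add]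
  | mem_mul y hy i x _ h =>
    obtain ⟨y, rfl⟩ := hy
    have := ExteriorAlgebra.ι_add_mul_swap (R := ℝ) y m
    rw [mul_assoc, h, mul_smul_comm, ← mul_assoc, eq_neg_of_add_eq_zero_left this, pow_succ,
      mul_neg_one, neg_smul, neg_mul, smul_neg, mul_assoc]

theorem mul_comm_of_mem {M : Type*} [AddCommGroup M] [Module ℝ M] {a b : ℕ}
    {x y : ExteriorAlgebra ℝ M} (hx : x ∈ ⋀[ℝ]^a M) (hy : y ∈ ⋀[ℝ]^b M) :
    y * x = (-1 : ℝ) ^ (a * b) • (x * y) := by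
  change x ∈ LinearMap.range (ExteriorAlgebra.ι ℝ) ^ a at hx
  induction hx using Submodule.pow_induction_on_left' with
  | algebraMap r => simp [Algebra.commutes]
  | add x y i _ _ h h' => rw [add_mul, mul_add, h, h', smul_add]
  | mem_mul z hz i x _ h =>
    obtain ⟨z, rfl⟩ := hz
    rw [← mul_assoc, mul_ι_of_mem hy, smul_mul_assoc, mul_assoc, h, mul_smul_comm, smul_smul,
      mul_assoc, ← pow_add]
    congr 2
    rw [Nat.succ_eq_add_one]
    ring

/-! ### Nonvanishing products of covectors -/

theorem exists_linearIndependent_cons {v₀ : V} (hv₀ : v₀ ≠ 0) (N : ℕ)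
    (hN : N + 1 ≤ Module.finrank ℝ V) :
    ∃ v : Fin (N + 1) → V, v 0 = v₀ ∧ LinearIndependent ℝ v := by
  induction N with
  | zero => exact ⟨fun _ => v₀, rfl, by simpa using hv₀⟩
  | succ N ih =>
    obtain ⟨v, hv, hli⟩ := ih (by omega)
    obtain ⟨x, hx⟩ := exists_linearIndependent_snoc_of_lt_finrank hli (by omega)
    refine ⟨Fin.snoc v x, ?_, hx⟩
    rw [← hv, ← Fin.castSucc_zero, Fin.snoc_castSucc]

/-- A nonzero covector is the first factor of a nonzero product of covectors, of any length up to
the dimension. -/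
theorem exists_toForm_ι_mul_ιMulti_ne_zero [FiniteDimensional ℝ V] {w : V →L[ℝ] ℝ}
    (hw : w ≠ 0) (N : ℕ) (hN : N + 1 ≤ Module.finrank ℝ V) :
    ∃ e : Fin N → V →L[ℝ] ℝ,
      toForm (N + 1) (ExteriorAlgebra.ι ℝ w * ExteriorAlgebra.ιMulti ℝ N e) ≠ 0 := by
  obtain ⟨v₀, hv₀⟩ : ∃ v, w v ≠ 0 := by
    by_contra! h
    exact hw (ContinuousLinearMap.ext h)
  obtain ⟨v, rfl, hli⟩ := exists_linearIndependent_cons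
    (v₀ := v₀) (fun h => hv₀ (by rw [h, map_zero])) N hN
  obtain ⟨Θ, hΘ⟩ := (Fintype.linearCombination ℝ v).exists_leftInverse_of_injective
    (LinearMap.ker_eq_bot.2 hli.fintypeLinearCombination_injective)
  have hΘv : ∀ i j, Θ (v j) i = if i = j then 1 else 0 := by
    intro i j
    have h := LinearMap.congr_fun hΘ (Pi.single j 1)
    simp only [LinearMap.comp_apply, Fintype.linearCombination_apply_single, one_smul,
      LinearMap.id_apply] at h
    rw [h, Pi.single_apply]
  let c : Fin (N + 1) → V →L[ℝ] ℝ := fun i =>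
    LinearMap.toContinuousLinearMap (LinearMap.proj i ∘ₗ Θ)
  have hc : ∀ i j, c i (v j) = if i = j then 1 else 0 := hΘv
  refine ⟨fun i => c i.succ, fun h => hv₀ ?_⟩
  have h1 : ExteriorAlgebra.ι ℝ w * ExteriorAlgebra.ιMulti ℝ N (fun i => c i.succ) =
      ExteriorAlgebra.ιMulti ℝ (N + 1) (Fin.cons w fun i => c i.succ) := by
    rw [ExteriorAlgebra.ιMulti_succ_apply]
    simp [Matrix.vecTail, Function.comp_def]
  rw [h1, toForm_ιMulti] at h
  have h2 := congrArg (fun A => A v) h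
  simp only [detForm_apply] at h2
  -- the rows below the first are those of the identity matrix
  rw [Matrix.det_of_isUpperTriangular] at h2
  · rw [Fin.prod_univ_succ] at h2
    simpa [hc] using h2
  · intro i j hij
    refine Fin.cases (fun h => absurd h (Fin.not_lt_zero j)) (fun i h => ?_) i hij
    have h' : j < i.succ := h
    simp [hc, h'.ne']

/-! ### Families of alternating forms -/

/-- Smoothness of a family of alternating forms on a finite-dimensional space can be tested on
vectors, as such a form is determined by finitely many of its values. -/
theorem contDiffAt_of_apply [FiniteDimensional ℝ V] {X : Type*} [NormedAddCommGroup X]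
    [NormedSpace ℝ X] {k : ℕ} {A : X → V [⋀^Fin k]→L[ℝ] ℝ} {x : X} {r : WithTop ℕ∞}
    (h : ∀ v : Fin k → V, ContDiffAt ℝ r (fun y => A y v) x) : ContDiffAt ℝ r A x := by
  let b := Module.finBasis ℝ V
  let Ψ : (V [⋀^Fin k]→L[ℝ] ℝ) →ₗ[ℝ] ((Fin k → Fin (Module.finrank ℝ V)) → ℝ) :=
    { toFun := fun f i => f fun j => b (i j)
      map_add' := fun _ _ => rfl
      map_smul' := fun _ _ => rfl }
  have hΨ : Function.Injective Ψ := by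
    intro f g hfg
    have : f.toAlternatingMap = g.toAlternatingMap :=
      AlternatingMap.coe_multilinearMap_injective
        (Module.Basis.ext_multilinear (fun _ => b) fun i => congrFun hfg i)
    exact ContinuousAlternatingMap.toAlternatingMap_injective this
  obtain ⟨Θ, hΘ⟩ := Ψ.exists_leftInverse_of_injective (LinearMap.ker_eq_bot.2 hΨ)
  have h1 : A = fun y => LinearMap.toContinuousLinearMap Θ (Ψ (A y)) := by
    funext y
    exact (LinearMap.congr_fun hΘ (A y)).symm
  rw [h1]
  refine (ContinuousLinearMap.contDiff _).contDiffAt.comp x ?_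
  rw [contDiffAt_pi]
  exact fun i => h _

theorem extDeriv_const {V : Type*} [NormedAddCommGroup V] [NormedSpace ℝ V] {k : ℕ}
    (A : V [⋀^Fin k]→L[ℝ] ℝ) (y : V) : extDeriv (fun _ => A) y = 0 := by
  ext v
  rw [extDeriv_apply (differentiableAt_const A)]
  simp

theorem eqRec_toForm {k l : ℕ} (h : k = l) (x : ExteriorAlgebra ℝ (V →L[ℝ] ℝ)) :
    (h ▸ toForm k x : V [⋀^Fin l]→L[ℝ] ℝ) = toForm l x := by
  subst h
  rfl

/-- The covector underlying a `1`-form. -/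
def covector (f : V [⋀^Fin 1]→L[ℝ] ℝ) : V →L[ℝ] ℝ :=
  (ContinuousAlternatingMap.ofSubsingletonLIE (𝕜 := ℝ) (E := V) (F := ℝ) (0 : Fin 1)).symm f

theorem toForm_ι_covector (f : V [⋀^Fin 1]→L[ℝ] ℝ) :
    toForm 1 (ExteriorAlgebra.ι ℝ (covector f)) = f := by
  ext v
  rw [toForm_ι]
  change f (fun _ => v 0) = f v
  congr 1
  funext i
  rw [Subsingleton.elim i 0]

/-- An expression that is linear in a differentiable family of covectors is differentiable. -/
theorem differentiableAt_toForm_linear [FiniteDimensional ℝ V] {X : Type*} [NormedAddCommGroup X]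
    [NormedSpace ℝ X] {k : ℕ} (L : (V →L[ℝ] ℝ) →ₗ[ℝ] ExteriorAlgebra ℝ (V →L[ℝ] ℝ))
    {W : X → V [⋀^Fin 1]→L[ℝ] ℝ} {y : X} (hW : DifferentiableAt ℝ W y) :
    DifferentiableAt ℝ (fun z => toForm k (L (covector (W z)))) y := by
  have h1 : DifferentiableAt ℝ (fun z => covector (W z)) y :=
    (ContinuousAlternatingMap.ofSubsingletonLIE (𝕜 := ℝ) (E := V) (F := ℝ)
      (0 : Fin 1)).symm.differentiable.differentiableAt.comp y hW
  exact (LinearMap.toContinuousLinearMap (toForm k ∘ₗ L)).differentiableAt.comp y h1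

theorem differentiableAt_add_smul {k : ℕ} {A : V [⋀^Fin k]→L[ℝ] ℝ}
    {u : V → ℝ} {G : V → V [⋀^Fin k]→L[ℝ] ℝ} {y : V}
    (hu : DifferentiableAt ℝ u y) (hG : DifferentiableAt ℝ G y) :
    DifferentiableAt ℝ (fun z => A + u z • G z) y :=
  (differentiableAt_const A).add (hu.smul hG)

/-- At a point where `u` vanishes or `G` is stationary, `d (A + u • G) = du ∧ G`. -/
theorem extDeriv_add_smul {k : ℕ} {A : V [⋀^Fin k]→L[ℝ] ℝ}
    {u : V → ℝ} {G : V → V [⋀^Fin k]→L[ℝ] ℝ} {y : V} {x : ExteriorAlgebra ℝ (V →L[ℝ] ℝ)}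
    (hx : x ∈ ⋀[ℝ]^k (V →L[ℝ] ℝ)) (hu : DifferentiableAt ℝ u y) (hG : DifferentiableAt ℝ G y)
    (huG : u y = 0 ∨ fderiv ℝ G y = 0) (hGx : G y = toForm k x) :
    extDeriv (fun z => A + u z • G z) y =
      toForm (k + 1) (ExteriorAlgebra.ι ℝ (fderiv ℝ u y) * x) := by
  have h0 : u y • fderiv ℝ G y = 0 := by
    ext v w
    change u y * fderiv ℝ G y v w = 0
    rcases huG with h | h <;> simp [h]
  rw [extDeriv, fderiv_const_add, fderiv_fun_smul hu hG, h0, zero_add, hGx,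
    alternatizeUncurryFin_smulRight_toForm _ hx]

end DiffForm

namespace DForm

open DiffForm

variable {n : ℕ} {M : Type*} [TopologicalSpace M] [ChartedSpace (EuclideanSpace ℝ (Fin n)) M]

/-! ### Algebraic operations in a chart -/

theorem inChart_add {k : ℕ} (η θ : DForm n M k) (q : M) (y : EuclideanSpace ℝ (Fin n)) :
    (η + θ).inChart q y = η.inChart q y + θ.inChart q y := rfl

theorem inChart_smul {k : ℕ} (r : ℝ) (η : DForm n M k) (q : M) (y : EuclideanSpace ℝ (Fin n)) :
    (r • η).inChart q y = r • η.inChart q y := rfl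

theorem inChart_zero {k : ℕ} (q : M) (y : EuclideanSpace ℝ (Fin n)) :
    (0 : DForm n M k).inChart q y = 0 := rfl

theorem inChart_wedge {a b : ℕ} (α : DForm n M a) (β : DForm n M b) (q : M)
    (y : EuclideanSpace ℝ (Fin n)) :
    (α.wedge β).inChart q y = DiffForm.wedge (α.inChart q y) (β.inChart q y) :=
  DiffForm.wedge_compContinuousLinearMap _ _ _

theorem inChart_cast {k l : ℕ} (h : k = l) (η : DForm n M k) (q : M)
    (y : EuclideanSpace ℝ (Fin n)) :
    (η.cast h).inChart q y = h ▸ η.inChart q y := by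
  subst h
  rfl

variable [IsManifold (𝓡 n) ∞ M]

/-! ### Changes of charts and the exterior derivative -/

theorem mdifferentiableAt_extChartAt_symm {q : M} {y : EuclideanSpace ℝ (Fin n)}
    (hy : y ∈ (extChartAt (𝓡 n) q).target) :
    MDifferentiableAt (𝓡 n) (𝓡 n) (extChartAt (𝓡 n) q).symm y :=
  ((contMDiffOn_extChartAt_symm (n := ∞) q).contMDiffAt
    ((isOpen_extChartAt_target q).mem_nhds hy)).mdifferentiableAt (by simp)

theorem mdifferentiableAt_extChartAt' {q x : M} (hx : x ∈ (extChartAt (𝓡 n) q).source) :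
    MDifferentiableAt (𝓡 n) (𝓡 n) (extChartAt (𝓡 n) q) x :=
  ((contMDiffOn_extChartAt (n := ∞)).contMDiffAt
    ((chartAt _ q).open_source.mem_nhds (by simpa using hx))).mdifferentiableAt (by simp)

theorem mfderiv_extChartAt_apply_mfderiv_symm {p q : M} {y : EuclideanSpace ℝ (Fin n)}
    (hy : y ∈ (extChartAt (𝓡 n) p).target)
    (hq : (extChartAt (𝓡 n) p).symm y ∈ (extChartAt (𝓡 n) q).source)
    (u : EuclideanSpace ℝ (Fin n)) :
    mfderiv (𝓡 n) (𝓡 n) (extChartAt (𝓡 n) q) ((extChartAt (𝓡 n) p).symm y)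
        (mfderiv (𝓡 n) (𝓡 n) (extChartAt (𝓡 n) p).symm y u) =
      fderiv ℝ (extChartAt (𝓡 n) q ∘ (extChartAt (𝓡 n) p).symm) y u := by
  rw [← mfderiv_eq_fderiv, mfderiv_comp y (mdifferentiableAt_extChartAt' hq)
    (mdifferentiableAt_extChartAt_symm hy)]
  rfl

theorem mfderiv_symm_apply_mfderiv_extChartAt {q x : M} (hx : x ∈ (extChartAt (𝓡 n) q).source)
    (u : TangentSpace (𝓡 n) x) :
    mfderiv (𝓡 n) (𝓡 n) (extChartAt (𝓡 n) q).symm (extChartAt (𝓡 n) q x)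
        (mfderiv (𝓡 n) (𝓡 n) (extChartAt (𝓡 n) q) x u) = u := by
  have h := mfderiv_comp x (mdifferentiableAt_extChartAt_symm ((extChartAt (𝓡 n) q).map_source hx))
    (mdifferentiableAt_extChartAt' hx)
  have h2 : (extChartAt (𝓡 n) q).symm ∘ (extChartAt (𝓡 n) q) =ᶠ[𝓝 x] id := by
    filter_upwards [(isOpen_extChartAt_source q).mem_nhds hx] with z hz
    exact (extChartAt (𝓡 n) q).left_inv hz
  rw [h2.mfderiv_eq, mfderiv_id] at h
  exact (congrArg (fun A => A u) h).symm

theorem contDiffAt_extChartAt_comp_symm {p q : M} {y : EuclideanSpace ℝ (Fin n)}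
    (hy : y ∈ (extChartAt (𝓡 n) p).target)
    (hq : (extChartAt (𝓡 n) p).symm y ∈ (extChartAt (𝓡 n) q).source) :
    ContDiffAt ℝ ∞ (extChartAt (𝓡 n) q ∘ (extChartAt (𝓡 n) p).symm) y := by
  rw [← contMDiffAt_iff_contDiffAt]
  exact ((contMDiffOn_extChartAt (n := ∞)).contMDiffAt
    ((chartAt _ q).open_source.mem_nhds (by simpa using hq))).comp y
    ((contMDiffOn_extChartAt_symm (n := ∞) p).contMDiffAt
    ((isOpen_extChartAt_target p).mem_nhds hy))

/-- Change of charts: the expressions of a form in two charts correspond under pullback by the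
transition map. -/
theorem inChart_eq_pullback {k : ℕ} (η : DForm n M k) {p q : M} {y : EuclideanSpace ℝ (Fin n)}
    (hy : y ∈ (extChartAt (𝓡 n) p).target)
    (hq : (extChartAt (𝓡 n) p).symm y ∈ (extChartAt (𝓡 n) q).source) :
    η.inChart p y =
      (η.inChart q ((extChartAt (𝓡 n) q ∘ (extChartAt (𝓡 n) p).symm) y)).compContinuousLinearMap
        (fderiv ℝ (extChartAt (𝓡 n) q ∘ (extChartAt (𝓡 n) p).symm) y) := by
  ext v
  let η' : M → EuclideanSpace ℝ (Fin n) [⋀^Fin k]→L[ℝ] ℝ := η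
  have hz := (extChartAt (𝓡 n) q).left_inv hq
  change η' ((extChartAt (𝓡 n) p).symm y)
      (fun i => mfderiv (𝓡 n) (𝓡 n) (extChartAt (𝓡 n) p).symm y (v i)) =
    η' ((extChartAt (𝓡 n) q).symm (extChartAt (𝓡 n) q ((extChartAt (𝓡 n) p).symm y)))
      (fun i => mfderiv (𝓡 n) (𝓡 n) (extChartAt (𝓡 n) q).symm
        (extChartAt (𝓡 n) q ((extChartAt (𝓡 n) p).symm y))
        (fderiv ℝ (extChartAt (𝓡 n) q ∘ (extChartAt (𝓡 n) p).symm) y (v i)))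
  rw [hz]
  congr 1
  funext i
  rw [← mfderiv_extChartAt_apply_mfderiv_symm hy hq]
  exact (mfderiv_symm_apply_mfderiv_extChartAt hq _).symm

/-- In a chart, `d` is the exterior derivative of `ℝⁿ`. As `DForm.d` uses at each point the
preferred chart of that point, this is the naturality of `extDeriv` under transition maps. -/
theorem inChart_d {k : ℕ} (η : DForm n M k) {q : M} {y : EuclideanSpace ℝ (Fin n)}
    (hy : y ∈ (extChartAt (𝓡 n) q).target) (hη : DifferentiableAt ℝ (η.inChart q) y) :
    η.d.inChart q y = extDeriv (η.inChart q) y := by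
  set x : M := (extChartAt (𝓡 n) q).symm y with hx
  have hxq : x ∈ (extChartAt (𝓡 n) q).source := (extChartAt (𝓡 n) q).map_target hy
  have hxx : x ∈ (extChartAt (𝓡 n) x).source := mem_extChartAt_source x
  have hyx : extChartAt (𝓡 n) x x ∈ (extChartAt (𝓡 n) x).target := mem_extChartAt_target x
  have hsx : (extChartAt (𝓡 n) x).symm (extChartAt (𝓡 n) x x) = x := extChartAt_to_inv x
  set σ := extChartAt (𝓡 n) q ∘ (extChartAt (𝓡 n) x).symm with hσ
  have hσy : σ (extChartAt (𝓡 n) x x) = y := by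
    simp only [hσ, Function.comp_apply, hsx]
    exact (extChartAt (𝓡 n) q).right_inv hy
  have hσd : ContDiffAt ℝ ∞ σ (extChartAt (𝓡 n) x x) :=
    contDiffAt_extChartAt_comp_symm hyx (by rw [hsx]; exact hxq)
  have hev : η.inChart x =ᶠ[𝓝 (extChartAt (𝓡 n) x x)]
      fun z => (η.inChart q (σ z)).compContinuousLinearMap (fderiv ℝ σ z) := by
    have hc : ContinuousAt (extChartAt (𝓡 n) x).symm (extChartAt (𝓡 n) x x) :=
      continuousAt_extChartAt_symm x
    filter_upwards [extChartAt_target_mem_nhds (I := 𝓡 n) x,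
      hc.preimage_mem_nhds ((isOpen_extChartAt_source q).mem_nhds (by rw [hsx]; exact hxq))]
      with z hz hz'
    exact inChart_eq_pullback η hz hz'
  have h1 : extDeriv (η.inChart x) (extChartAt (𝓡 n) x x) =
      (extDeriv (η.inChart q) y).compContinuousLinearMap
        (fderiv ℝ σ (extChartAt (𝓡 n) x x)) := by
    rw [hev.extDeriv_eq, extDeriv_pullback (r := ∞) (by rwa [hσy]) hσd
      (by rw [minSmoothness_of_isRCLikeNormedField]; exact WithTop.coe_le_coe.2 le_top), hσy]
  ext v
  change extDeriv (η.inChart x) (extChartAt (𝓡 n) x x) (fun i =>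
    mfderiv (𝓡 n) (𝓡 n) (extChartAt (𝓡 n) x) x
      (mfderiv (𝓡 n) (𝓡 n) (extChartAt (𝓡 n) q).symm y (v i))) = _
  rw [h1]
  change extDeriv (η.inChart q) y (fun i => fderiv ℝ σ (extChartAt (𝓡 n) x x)
    (mfderiv (𝓡 n) (𝓡 n) (extChartAt (𝓡 n) x) x
      (mfderiv (𝓡 n) (𝓡 n) (extChartAt (𝓡 n) q).symm y (v i)))) = _
  -- it remains to see that the differentials of the two transition maps are mutually inverse
  congr 1
  funext i
  set τ := extChartAt (𝓡 n) x ∘ (extChartAt (𝓡 n) q).symm with hτ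
  have hτd : ContDiffAt ℝ ∞ τ y := contDiffAt_extChartAt_comp_symm hy hxx
  have h2 : fderiv ℝ (σ ∘ τ) y = (fderiv ℝ σ (τ y)).comp (fderiv ℝ τ y) :=
    fderiv_comp y (hσd.differentiableAt (by simp)) (hτd.differentiableAt (by simp))
  have h3 : σ ∘ τ =ᶠ[𝓝 y] id := by
    have hc : ContinuousAt (extChartAt (𝓡 n) q).symm y :=
      (mdifferentiableAt_extChartAt_symm hy).continuousAt
    filter_upwards [(isOpen_extChartAt_target q).mem_nhds hy,
      hc.preimage_mem_nhds ((isOpen_extChartAt_source x).mem_nhds hxx)] with z hz hz'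
    simp only [hσ, hτ, Function.comp_apply]
    rw [(extChartAt (𝓡 n) x).left_inv hz', (extChartAt (𝓡 n) q).right_inv hz]
    rfl
  have h4 := mfderiv_extChartAt_apply_mfderiv_symm hy hxx (v i)
  rw [h3.fderiv_eq, fderiv_id] at h2
  exact (congrArg (fderiv ℝ σ (extChartAt (𝓡 n) x x)) h4).trans
    (congrArg (fun A => A (v i)) h2).symm

theorem eq_zero_of_inChart_eq_zero {k : ℕ} (η : DForm n M k) {q : M}
    (h : η.inChart q (extChartAt (𝓡 n) q q) = 0) : η q = 0 := by
  ext v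
  let η' : M → EuclideanSpace ℝ (Fin n) [⋀^Fin k]→L[ℝ] ℝ := η
  have h1 := congrArg (fun A => A fun i => mfderiv (𝓡 n) (𝓡 n) (extChartAt (𝓡 n) q) q (v i)) h
  change η' ((extChartAt (𝓡 n) q).symm (extChartAt (𝓡 n) q q)) (fun i =>
    mfderiv (𝓡 n) (𝓡 n) (extChartAt (𝓡 n) q).symm (extChartAt (𝓡 n) q q)
      (mfderiv (𝓡 n) (𝓡 n) (extChartAt (𝓡 n) q) q (v i))) = 0 at h1
  rw [extChartAt_to_inv] at h1
  refine Eq.trans ?_ h1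
  change η' q v = _
  congr 1
  funext i
  exact (mfderiv_symm_apply_mfderiv_extChartAt (mem_extChartAt_source q) _).symm

/-! ### Smooth forms with prescribed germ -/

/-- Every form `u • A` on `ℝⁿ` with `u` a smooth function and `A` constant is, near a given point
of a chart, the expression of a smooth form on `M`. -/
theorem exists_isSmooth_inChart_eventuallyEq [T2Space M] (q : M)
    {u : EuclideanSpace ℝ (Fin n) → ℝ}
    (hu : ContDiff ℝ ∞ u) {k : ℕ} (A : EuclideanSpace ℝ (Fin n) [⋀^Fin k]→L[ℝ] ℝ) :
    ∃ η : DForm n M k, η.IsSmooth ∧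
      η.inChart q =ᶠ[𝓝 (extChartAt (𝓡 n) q q)] fun y => u y • A := by
  obtain ⟨χ⟩ : Nonempty (SmoothBumpFunction (𝓡 n) q) := inferInstance
  let c : M → ℝ := fun x => χ x • u (extChartAt (𝓡 n) q x)
  have hc : ContMDiff (𝓡 n) 𝓘(ℝ, ℝ) ∞ c :=
    χ.contMDiff_smul (hu.contMDiff.comp_contMDiffOn contMDiffOn_extChartAt)
  let η : DForm n M k := fun x =>
    c x • A.compContinuousLinearMap (mfderiv (𝓡 n) (𝓡 n) (extChartAt (𝓡 n) q) x)
  have hη : ∀ (p : M) (y : EuclideanSpace ℝ (Fin n)), y ∈ (extChartAt (𝓡 n) p).target →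
      (extChartAt (𝓡 n) p).symm y ∈ (extChartAt (𝓡 n) q).source →
      η.inChart p y = c ((extChartAt (𝓡 n) p).symm y) • A.compContinuousLinearMap
        (fderiv ℝ (extChartAt (𝓡 n) q ∘ (extChartAt (𝓡 n) p).symm) y) := by
    intro p y hy hq
    ext v
    change c ((extChartAt (𝓡 n) p).symm y) * A (fun i =>
      mfderiv (𝓡 n) (𝓡 n) (extChartAt (𝓡 n) q) ((extChartAt (𝓡 n) p).symm y)
        (mfderiv (𝓡 n) (𝓡 n) (extChartAt (𝓡 n) p).symm y (v i))) =
      c ((extChartAt (𝓡 n) p).symm y) * A (fun i =>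
        fderiv ℝ (extChartAt (𝓡 n) q ∘ (extChartAt (𝓡 n) p).symm) y (v i))
    simp only [mfderiv_extChartAt_apply_mfderiv_symm hy hq]
  refine ⟨η, fun p y hy => ?_, ?_⟩
  · have hs : ContMDiffAt (𝓡 n) (𝓡 n) ∞ (extChartAt (𝓡 n) p).symm y :=
      (contMDiffOn_extChartAt_symm (n := ∞) p).contMDiffAt
        ((isOpen_extChartAt_target p).mem_nhds hy)
    have hcs : ContDiffAt ℝ ∞ (fun z => c ((extChartAt (𝓡 n) p).symm z)) y :=
      contMDiffAt_iff_contDiffAt.1 (hc.contMDiffAt.comp y hs)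
    have htgt := (isOpen_extChartAt_target (I := 𝓡 n) p).mem_nhds hy
    refine ContDiffAt.contDiffWithinAt ?_
    by_cases hq : (extChartAt (𝓡 n) p).symm y ∈ (extChartAt (𝓡 n) q).source
    · have hev : η.inChart p =ᶠ[𝓝 y] fun z => c ((extChartAt (𝓡 n) p).symm z) •
          A.compContinuousLinearMap
            (fderiv ℝ (extChartAt (𝓡 n) q ∘ (extChartAt (𝓡 n) p).symm) z) := by
        filter_upwards [htgt, hs.continuousAt.preimage_mem_nhds
          ((isOpen_extChartAt_source q).mem_nhds hq)] with z hz hz'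
        exact hη p z hz hz'
      refine ContDiffAt.congr_of_eventuallyEq (hcs.smul ?_) hev
      refine DiffForm.contDiffAt_of_apply fun v => ?_
      have hd : ContDiffAt ℝ ∞ (fderiv ℝ (extChartAt (𝓡 n) q ∘ (extChartAt (𝓡 n) p).symm)) y :=
        (contDiffAt_extChartAt_comp_symm hy hq).fderiv_right (m := ∞) (by simp)
      exact A.toContinuousMultilinearMap.contDiff.contDiffAt.comp y
        (contDiffAt_pi.2 fun i => hd.clm_apply contDiffAt_const)
    -- away from the support of the bump function the form vanishes near the point
    · have hq' : (extChartAt (𝓡 n) p).symm y ∉ tsupport χ :=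
        fun h => hq (χ.tsupport_subset_extChartAt_source h)
      have hev : η.inChart p =ᶠ[𝓝 y] fun _ => 0 := by
        filter_upwards [hs.continuousAt.preimage_mem_nhds
          ((isClosed_tsupport χ).isOpen_compl.mem_nhds hq')] with z hz
        have : c ((extChartAt (𝓡 n) p).symm z) = 0 := by
          simp only [c]
          rw [image_eq_zero_of_notMem_tsupport hz, zero_smul]
        ext v
        change c ((extChartAt (𝓡 n) p).symm z) * _ = 0
        rw [this, zero_mul]
      exact contDiffAt_const.congr_of_eventuallyEq hev
  · have hcont : ContinuousAt (extChartAt (𝓡 n) q).symm (extChartAt (𝓡 n) q q) :=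
      continuousAt_extChartAt_symm q
    have h1 : ∀ᶠ x in 𝓝 ((extChartAt (𝓡 n) q).symm (extChartAt (𝓡 n) q q)), χ x = 1 := by
      rw [extChartAt_to_inv]
      exact χ.eventuallyEq_one
    filter_upwards [extChartAt_target_mem_nhds (I := 𝓡 n) q, hcont.eventually h1,
      eventually_eventually_nhds.2 (extChartAt_target_mem_nhds (I := 𝓡 n) q)] with y hy hχ hev
    rw [hη q y hy ((extChartAt (𝓡 n) q).map_target hy)]
    have h2 : extChartAt (𝓡 n) q ∘ (extChartAt (𝓡 n) q).symm =ᶠ[𝓝 y] id := by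
      filter_upwards [hev] with z hz
      exact (extChartAt (𝓡 n) q).right_inv hz
    rw [h2.fderiv_eq, fderiv_id]
    simp only [c, hχ, (extChartAt (𝓡 n) q).right_inv hy, one_smul]
    rfl

local notation "𝔼" => EuclideanSpace ℝ (Fin n)
local notation "Λ" => ExteriorAlgebra ℝ (EuclideanSpace ℝ (Fin n) →L[ℝ] ℝ)
local notation "ι" => ExteriorAlgebra.ι ℝ

theorem exists_isSmooth_toForm [T2Space M] (q : M) {u : 𝔼 → ℝ} (hu : ContDiff ℝ ∞ u) (k : ℕ)
    (x : Λ) : ∃ η : DForm n M k, η.IsSmooth ∧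
      η.inChart q =ᶠ[𝓝 (extChartAt (𝓡 n) q q)] fun y => toForm k (u y • x) := by
  obtain ⟨η, h1, h2⟩ := exists_isSmooth_inChart_eventuallyEq q hu (toForm k x)
  exact ⟨η, h1, by simpa only [map_smul] using h2⟩

theorem exists_isSmooth_toForm_const [T2Space M] (q : M) (k : ℕ) (x : Λ) :
    ∃ η : DForm n M k, η.IsSmooth ∧
      η.inChart q =ᶠ[𝓝 (extChartAt (𝓡 n) q q)] fun _ => toForm k x := by
  simpa using exists_isSmooth_toForm q (u := fun _ => 1) contDiff_const k x

/-! ### The bracket in a chart -/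

/-- The bracket in a chart, for forms whose expressions come from the exterior algebra of the dual;
`Z` is any convenient way of writing the expression of `α ∧ β`. -/
theorem inChart_bracket {F : ℕ → ℕ → ℝ} {t : ℝ} {φ : DForm n M 1} {a b : ℕ} {α : DForm n M a}
    {β : DForm n M b} {q : M} {y : 𝔼} (hy : y ∈ (extChartAt (𝓡 n) q).target) {X Y : 𝔼 → Λ}
    (hX : ∀ z, X z ∈ ⋀[ℝ]^a (𝔼 →L[ℝ] ℝ)) (hY : ∀ z, Y z ∈ ⋀[ℝ]^b (𝔼 →L[ℝ] ℝ))
    (hα : α.inChart q =ᶠ[𝓝 y] fun z => toForm a (X z))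
    (hβ : β.inChart q =ᶠ[𝓝 y] fun z => toForm b (Y z))
    {Z : 𝔼 → 𝔼 [⋀^Fin (a + b)]→L[ℝ] ℝ} (hZ : ∀ z, toForm (a + b) (X z * Y z) = Z z)
    (hd : DifferentiableAt ℝ Z y) :
    (bracket F t φ α β).inChart q y = (-1 : ℝ) ^ a • extDeriv Z y +
      toForm (a + b + 1) ((F a b * t) • (X y * ι (covector (φ.inChart q y)) * Y y)) := by
  have h1 : (α.wedge β).inChart q =ᶠ[𝓝 y] Z := by
    filter_upwards [hα, hβ] with z hz hz'
    rw [inChart_wedge, hz, hz', wedge_toForm (hX z) (hY z), hZ]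
  have hι : ι (covector (φ.inChart q y)) ∈ ⋀[ℝ]^1 (𝔼 →L[ℝ] ℝ) := by
    simp
  rw [bracket, inChart_add, inChart_smul, inChart_smul, inChart_d _ hy
    (hd.congr_of_eventuallyEq h1), h1.extDeriv_eq, inChart_cast, inChart_wedge, inChart_wedge,
    inChart_smul, hα.self_of_nhds, hβ.self_of_nhds, wedge_smul_right, wedge_smul_left,
    ← toForm_ι_covector (φ.inChart q y), wedge_toForm (hX y) hι,
    wedge_toForm (by exact SetLike.mul_mem_graded (hX y) hι) (hY y), ← map_smul, eqRec_toForm,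
    ← map_smul, smul_smul, toForm_ι_covector]

/-- The bracket in a chart when `α ∧ β` is `u • p` with `p` constant. -/
theorem inChart_bracket_of_mul_eq_smul {F : ℕ → ℕ → ℝ} {t : ℝ} {φ : DForm n M 1} {a b : ℕ}
    {α : DForm n M a} {β : DForm n M b} {q : M} {y : 𝔼}
    (hy : y ∈ (extChartAt (𝓡 n) q).target) {X Y : 𝔼 → Λ}
    (hX : ∀ z, X z ∈ ⋀[ℝ]^a (𝔼 →L[ℝ] ℝ)) (hY : ∀ z, Y z ∈ ⋀[ℝ]^b (𝔼 →L[ℝ] ℝ))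
    (hα : α.inChart q =ᶠ[𝓝 y] fun z => toForm a (X z))
    (hβ : β.inChart q =ᶠ[𝓝 y] fun z => toForm b (Y z))
    {u : 𝔼 → ℝ} (hu : DifferentiableAt ℝ u y) {p : Λ} (hp : p ∈ ⋀[ℝ]^(a + b) (𝔼 →L[ℝ] ℝ))
    (hXY : ∀ z, X z * Y z = u z • p) :
    (bracket F t φ α β).inChart q y = toForm (a + b + 1)
      ((-1 : ℝ) ^ a • (ι (fderiv ℝ u y) * p) +
        (F a b * t) • (X y * ι (covector (φ.inChart q y)) * Y y)) := by
  rw [inChart_bracket hy hX hY hα hβ (Z := fun z => 0 + u z • toForm (a + b) p)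
    (fun z => by rw [hXY, map_smul, zero_add])
    (differentiableAt_add_smul hu (differentiableAt_const _)),
    extDeriv_add_smul hp hu (differentiableAt_const _) (Or.inr (by simp)) rfl,
    ← map_smul, ← map_add]

/-- The bracket at a zero `y` of `u`, when `α ∧ β` is a constant plus `u` times a form that contains
`φ` as a factor. Since `u y = 0`, the differential of `φ` does not enter. -/
theorem inChart_bracket_of_mul_eq_add {F : ℕ → ℕ → ℝ} {t : ℝ} {φ : DForm n M 1} {a b : ℕ}
    {α : DForm n M a} {β : DForm n M b} {q : M} {y : 𝔼}
    (hy : y ∈ (extChartAt (𝓡 n) q).target) {X Y : 𝔼 → Λ}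
    (hX : ∀ z, X z ∈ ⋀[ℝ]^a (𝔼 →L[ℝ] ℝ)) (hY : ∀ z, Y z ∈ ⋀[ℝ]^b (𝔼 →L[ℝ] ℝ))
    (hα : α.inChart q =ᶠ[𝓝 y] fun z => toForm a (X z))
    (hβ : β.inChart q =ᶠ[𝓝 y] fun z => toForm b (Y z))
    (hφ : DifferentiableAt ℝ (φ.inChart q) y)
    {u : 𝔼 → ℝ} (hu : DifferentiableAt ℝ u y) (hu0 : u y = 0) {p r s : Λ}
    (hrs : r * ι (covector (φ.inChart q y)) * s ∈ ⋀[ℝ]^(a + b) (𝔼 →L[ℝ] ℝ))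
    (hXY : ∀ z, X z * Y z = p + u z • (r * ι (covector (φ.inChart q z)) * s)) :
    (bracket F t φ α β).inChart q y = toForm (a + b + 1)
      ((-1 : ℝ) ^ a • (ι (fderiv ℝ u y) * (r * ι (covector (φ.inChart q y)) * s)) +
        (F a b * t) • (X y * ι (covector (φ.inChart q y)) * Y y)) := by
  have hG : DifferentiableAt ℝ (fun z => (toForm (a + b)
      (r * ι (covector (φ.inChart q z)) * s) : 𝔼 [⋀^Fin (a + b)]→L[ℝ] ℝ)) y :=
    differentiableAt_toForm_linear (LinearMap.mulRight ℝ s ∘ₗ LinearMap.mulLeft ℝ r ∘ₗ ι) hφ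
  rw [inChart_bracket hy hX hY hα hβ (Z := fun z => toForm (a + b) p +
      u z • toForm (a + b) (r * ι (covector (φ.inChart q z)) * s))
    (fun z => by rw [hXY, map_add, map_smul])
    (differentiableAt_add_smul hu hG),
    extDeriv_add_smul hrs hu hG (Or.inl hu0) rfl, ← map_smul, ← map_add]

/-! ### Evaluation of the identities on test forms -/

/-- Super-symmetry at `q`, tested on forms that are constant near `q` in the chart around `q`: the
exact terms vanish there. -/
theorem SuperSymmetric.relation [T2Space M] {F : ℕ → ℕ → ℝ} {t : ℝ} {φ : DForm n M 1}
    (h : SuperSymmetric F t φ) (q : M) {a b : ℕ} {x z : Λ}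
    (hx : x ∈ ⋀[ℝ]^a (𝔼 →L[ℝ] ℝ)) (hz : z ∈ ⋀[ℝ]^b (𝔼 →L[ℝ] ℝ)) :
    toForm (a + b + 1) (((F a b - F b a) * t) •
      (x * ι (covector (φ.inChart q (extChartAt (𝓡 n) q q))) * z)) = 0 := by
  obtain ⟨α, hα, hα'⟩ := exists_isSmooth_toForm_const q a x
  obtain ⟨β, hβ, hβ'⟩ := exists_isSmooth_toForm_const q b z
  have h1 := congrArg (fun η => inChart η q (extChartAt (𝓡 n) q q)) (h a b α β hα hβ)
  have hy := mem_extChartAt_target (I := 𝓡 n) q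
  simp only [inChart_add, inChart_smul, inChart_cast, inChart_zero] at h1
  rw [inChart_bracket hy (fun _ => hx) (fun _ => hz) hα' hβ' (fun _ => rfl)
    (differentiableAt_const _), inChart_bracket hy (fun _ => hz) (fun _ => hx) hβ' hα'
    (fun _ => rfl) (differentiableAt_const _), extDeriv_const, extDeriv_const, smul_zero,
    smul_zero, zero_add, zero_add, eqRec_toForm, ← map_smul, ← map_add] at h1
  rw [← h1]
  congr 1
  set m := covector (φ.inChart q (extChartAt (𝓡 n) q q))
  have e1 : z * ι m * x = ((-1 : ℝ) ^ (a * b) * (-1) ^ a * (-1) ^ b) • (x * ι m * z) := by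
    rw [mul_ι_of_mem hz, mul_ι_of_mem hx, smul_mul_assoc, smul_mul_assoc, mul_assoc,
      mul_comm_of_mem hx hz, mul_smul_comm, ← mul_assoc, smul_smul, smul_smul]
    congr 1
    have : ((-1 : ℝ) ^ a) * (-1) ^ a = 1 := by rw [← mul_pow]; simp
    linear_combination (-(-1 : ℝ) ^ b * (-1) ^ (a * b)) * this
  rw [e1, smul_smul, smul_smul, ← add_smul]
  congr 1
  rcases Nat.even_or_odd a with ha | ha <;> rcases Nat.even_or_odd b with hb | hb <;>
    simp [ha.neg_one_pow, hb.neg_one_pow, pow_add, pow_mul, add_mul, mul_add] <;> ring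

/-- The signs of the Jacobi sum that occurs in `SuperJacobi.relation`, collected after moving all
factors into the order `m, l, x, z`. -/
theorem sum_signs {W : Type*} [AddCommGroup W] [Module ℝ W] {b c : ℕ} {x z : ExteriorAlgebra ℝ W}
    (hx : x ∈ ⋀[ℝ]^b W) (hz : z ∈ ⋀[ℝ]^c W) (l m : W) (f₁ f₂ f₃ f₄ f₅ t : ℝ) :
    (-1 : ℝ) ^ (c + 1) • ((-1 : ℝ) ^ (b + 1) • (f₁ * t) • (ι l * ι m * x * z) +
        (f₂ * t) • (ι l * x * ι m * z)) +
      (-1 : ℝ) ^ (b + 1) • ((-1 : ℝ) ^ (b + c + 1) • (f₃ * t) • (ι l * x * ι m * z) +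
        (f₄ * t) • (-1 : ℝ) ^ b • (ι l * (x * z) * ι m)) +
      (-1 : ℝ) ^ ((c + 1) * (b + 1)) • (-1 : ℝ) ^ (c + 1) • (f₅ * t) • (ι l * z * ι m * x) =
    ((-1 : ℝ) ^ (b + c + 1) * ((f₁ - f₂ + f₃ - f₄ + f₅) * t)) • (ι m * ι l * x * z) := by
  have e0 : ι l * ι m = -(ι m * ι l) :=
    eq_neg_of_add_eq_zero_left (ExteriorAlgebra.ι_add_mul_swap l m)
  have e1 : ι l * ι m * x * z = (-1 : ℝ) • (ι m * ι l * x * z) := by rw [e0]; simp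
  have e2 : ι l * x * ι m * z = (-1 : ℝ) ^ (b + 1) • (ι m * ι l * x * z) := by
    rw [mul_assoc (ι l), mul_ι_of_mem hx, mul_smul_comm, smul_mul_assoc, ← mul_assoc, e1,
      smul_smul, pow_succ]
  have e3 : ι l * (x * z) * ι m = (-1 : ℝ) ^ (b + c + 1) • (ι m * ι l * x * z) := by
    rw [mul_assoc (ι l), mul_ι_of_mem (SetLike.mul_mem_graded hx hz : x * z ∈ ⋀[ℝ]^(b + c) W),
      mul_smul_comm, ← mul_assoc, ← mul_assoc, e1, smul_smul, pow_succ]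
  have e4 : ι l * z * ι m * x = (-1 : ℝ) ^ (c + 1 + b * c) • (ι m * ι l * x * z) := by
    rw [mul_assoc (ι l), mul_ι_of_mem hz, mul_smul_comm, smul_mul_assoc, ← mul_assoc,
      mul_assoc _ z x, mul_comm_of_mem hx hz, mul_smul_comm, ← mul_assoc, e1, smul_smul, smul_smul]
    congr 1
    ring
  rw [e1, e2, e3, e4]
  simp only [smul_smul, ← add_smul]
  congr 1
  rcases Nat.even_or_odd b with hb | hb <;> rcases Nat.even_or_odd c with hc | hc <;>
    simp [hb.neg_one_pow, hc.neg_one_pow, pow_add, pow_mul, add_mul, mul_add] <;> ring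

/-- The Jacobi identity at `q`, tested on `1`, `u x` and `z`, where `x` and `z` are constant in the
chart around `q` and `u` is the affine function with differential `l` that vanishes at `q`. As
`u` vanishes at `q`, the terms with `dφ` drop out, so this holds whether or not `φ` is closed. -/
theorem SuperJacobi.relation [T2Space M] {F : ℕ → ℕ → ℝ} {t : ℝ} {φ : DForm n M 1}
    (hφ : φ.IsSmooth) (h : SuperJacobi F t φ) (q : M) {b c : ℕ} {x z : Λ}
    (hx : x ∈ ⋀[ℝ]^b (𝔼 →L[ℝ] ℝ)) (hz : z ∈ ⋀[ℝ]^c (𝔼 →L[ℝ] ℝ)) (l : 𝔼 →L[ℝ] ℝ) :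
    toForm (b + c + 2) (((F 0 b - F (b + 1) c + F b c - F (b + c + 1) 0 + F c 0) * t) •
      (ι (covector (φ.inChart q (extChartAt (𝓡 n) q q))) * ι l * x * z)) = 0 := by
  set y₀ := extChartAt (𝓡 n) q q with hy₀
  set w : 𝔼 → (𝔼 →L[ℝ] ℝ) := fun y => covector (φ.inChart q y) with hw
  set u : 𝔼 → ℝ := fun y => l (y - y₀) with hu
  have hus : ContDiff ℝ ∞ u := l.contDiff.comp (contDiff_id.sub contDiff_const)
  have hud : ∀ y, HasFDerivAt u l y := fun y =>
    l.hasFDerivAt.comp y ((hasFDerivAt_id y).sub_const y₀)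
  have huf : ∀ y, fderiv ℝ u y = l := fun y => (hud y).fderiv
  have hu0 : u y₀ = 0 := by simp [hu]
  have htgt : (extChartAt (𝓡 n) q).target ∈ 𝓝 y₀ := extChartAt_target_mem_nhds q
  have hy : y₀ ∈ (extChartAt (𝓡 n) q).target := mem_extChartAt_target q
  have hφd : DifferentiableAt ℝ (φ.inChart q) y₀ :=
    ((hφ q).contDiffAt htgt).differentiableAt (by simp)
  obtain ⟨α, hα, hα'⟩ := exists_isSmooth_toForm_const q 0 (1 : Λ)
  obtain ⟨β, hβ, hβ'⟩ := exists_isSmooth_toForm q hus b x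
  obtain ⟨γ, hγ, hγ'⟩ := exists_isSmooth_toForm_const q c z
  have hone : (1 : Λ) ∈ ⋀[ℝ]^0 (𝔼 →L[ℝ] ℝ) := SetLike.GradedOne.one_mem
  have hι : ∀ m : 𝔼 →L[ℝ] ℝ, ι m ∈ ⋀[ℝ]^1 (𝔼 →L[ℝ] ℝ) := by simp
  have hm : ∀ {i j k : ℕ} {r s : Λ}, i + j = k → r ∈ ⋀[ℝ]^i (𝔼 →L[ℝ] ℝ) →
      s ∈ ⋀[ℝ]^j (𝔼 →L[ℝ] ℝ) → r * s ∈ ⋀[ℝ]^k (𝔼 →L[ℝ] ℝ) := by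
    rintro i j k r s rfl hr hs
    exact SetLike.mul_mem_graded hr hs
  have hux : ∀ y, u y • x ∈ ⋀[ℝ]^b (𝔼 →L[ℝ] ℝ) := fun y => Submodule.smul_mem _ _ hx
  have hw1 : ∀ y, ι (w y) ∈ ⋀[ℝ]^1 (𝔼 →L[ℝ] ℝ) := fun y => hι (w y)
  -- the three inner brackets near `q`
  have k1 : (bracket F t φ α β).inChart q =ᶠ[𝓝 y₀] fun y =>
      toForm (0 + b + 1) (ι l * x + u y • (F 0 b * t) • (ι (w y) * x)) := by
    filter_upwards [htgt, hα'.eventuallyEq_nhds, hβ'.eventuallyEq_nhds] with y hy h1 h2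
    rw [inChart_bracket_of_mul_eq_smul hy (fun _ => hone) hux h1 h2 (hud y).differentiableAt
      (hm rfl hone hx) (fun z => by rw [mul_smul_comm]), huf, pow_zero, one_smul, one_mul, one_mul,
      mul_smul_comm, smul_comm]
  have k2 : (bracket F t φ β γ).inChart q =ᶠ[𝓝 y₀] fun y =>
      toForm (b + c + 1) ((-1 : ℝ) ^ b • (ι l * (x * z)) +
        u y • (F b c * t) • (x * ι (w y) * z)) := by
    filter_upwards [htgt, hβ'.eventuallyEq_nhds, hγ'.eventuallyEq_nhds] with y hy h1 h2
    rw [inChart_bracket_of_mul_eq_smul hy hux (fun _ => hz) h1 h2 (hud y).differentiableAt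
      (hm rfl hx hz) (fun z => by rw [smul_mul_assoc]), huf, smul_mul_assoc, smul_mul_assoc,
      smul_comm (u y)]
  have k3 : (bracket F t φ γ α).inChart q =ᶠ[𝓝 y₀] fun y =>
      toForm (c + 0 + 1) ((F c 0 * t) • (z * ι (w y))) := by
    filter_upwards [htgt, hγ'.eventuallyEq_nhds, hα'.eventuallyEq_nhds] with y hy h1 h2
    rw [inChart_bracket hy (fun _ => hz) (fun _ => hone) h1 h2
      (fun _ => rfl) (differentiableAt_const _), extDeriv_const, smul_zero, zero_add, mul_one]
  -- the three outer brackets at `q`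
  have j1 : (bracket F t φ (bracket F t φ α β) γ).inChart q y₀ = toForm (0 + b + 1 + c + 1)
      ((-1 : ℝ) ^ (0 + b + 1) • (F 0 b * t) • (ι l * ι (w y₀) * x * z) +
        (F (0 + b + 1) c * t) • (ι l * x * ι (w y₀) * z)) := by
    rw [inChart_bracket_of_mul_eq_add (p := ι l * x * z) (r := (F 0 b * t) • 1) (s := x * z) hy
      (fun y => Submodule.add_mem _ (hm (by omega) (hι l) hx)
        (Submodule.smul_mem _ _ (Submodule.smul_mem _ _ (hm (by omega) (hw1 y) hx))))
      (fun _ => hz) k1 hγ' hφd (hud y₀).differentiableAt hu0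
      (hm (by omega) (hm (Nat.zero_add 1) (Submodule.smul_mem _ _ hone) (hw1 y₀)) (hm rfl hx hz))
      (fun y => by simp only [add_mul, mul_assoc, smul_mul_assoc, one_mul, hw]), huf, hu0]
    simp only [zero_smul, add_zero, smul_mul_assoc, one_mul, mul_smul_comm, mul_assoc, hw]
  have j2 : (bracket F t φ (bracket F t φ β γ) α).inChart q y₀ = toForm (b + c + 1 + 0 + 1)
      ((-1 : ℝ) ^ (b + c + 1) • (F b c * t) • (ι l * x * ι (w y₀) * z) +
        (F (b + c + 1) 0 * t) • (-1 : ℝ) ^ b • (ι l * (x * z) * ι (w y₀))) := by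
    rw [inChart_bracket_of_mul_eq_add (p := (-1 : ℝ) ^ b • (ι l * (x * z)))
      (r := (F b c * t) • x) (s := z) hy
      (fun y => Submodule.add_mem _
        (Submodule.smul_mem _ _ (hm (by omega) (hι l) (hm rfl hx hz)))
        (Submodule.smul_mem _ _ (Submodule.smul_mem _ _ (hm (by omega) (hm rfl hx (hw1 y)) hz))))
      (fun _ => hone) k2 hα' hφd (hud y₀).differentiableAt hu0
      (hm (by omega) (hm rfl (Submodule.smul_mem _ _ hx) (hw1 y₀)) hz)
      (fun y => by simp only [mul_assoc, smul_mul_assoc, mul_one, hw]), huf, hu0]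
    simp only [zero_smul, add_zero, smul_mul_assoc, mul_one, mul_smul_comm, mul_assoc, hw]
  have j3 : (bracket F t φ (bracket F t φ γ α) β).inChart q y₀ = toForm (c + 0 + 1 + b + 1)
      ((-1 : ℝ) ^ (c + 0 + 1) • (F c 0 * t) • (ι l * z * ι (w y₀) * x)) := by
    rw [inChart_bracket_of_mul_eq_add (p := 0) (r := (F c 0 * t) • z) (s := x) hy
      (fun y => Submodule.smul_mem _ _ (hm (by omega) hz (hw1 y)))
      hux k3 hβ' hφd (hud y₀).differentiableAt hu0
      (hm (by omega) (hm rfl (Submodule.smul_mem _ _ hz) (hw1 y₀)) hx)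
      (fun y => by simp only [mul_assoc, smul_mul_assoc, mul_smul_comm, zero_add, hw]), huf, hu0]
    simp only [zero_smul, mul_zero, smul_zero, add_zero, smul_mul_assoc, mul_smul_comm, mul_assoc,
      hw]
  have h1 := congrArg (fun η => inChart η q y₀) (h 0 b c α β γ hα hβ hγ)
  simp only [inChart_add, inChart_smul, inChart_cast, inChart_zero] at h1
  rw [j1, j2, j3, eqRec_toForm, eqRec_toForm, eqRec_toForm, ← map_smul, ← map_smul, ← map_smul,
    ← map_add, ← map_add] at h1
  simp only [Nat.zero_add, Nat.add_zero, one_mul, mul_one] at h1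
  rw [sum_signs hx hz, mul_smul, map_smul] at h1
  have h2 := (smul_eq_zero.1 h1).resolve_left (pow_ne_zero _ (by norm_num))
  rwa [Nat.zero_add] at h2

/-- Near a point, `[[1, 1], 1] = -F(0,0) t dφ`, because `φ ∧ φ = 0`; the Jacobi identity for
`1, 1, 1` thus reads `3 F(0,0) t dφ = 0`. -/
theorem SuperJacobi.apply_zero_zero [T2Space M] {F : ℕ → ℕ → ℝ} {t : ℝ} (ht : t ≠ 0)
    {φ : DForm n M 1} (hφ : φ.IsSmooth) (h : SuperJacobi F t φ) (hc : ¬ φ.IsClosed) :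
    F 0 0 = 0 := by
  obtain ⟨q, hq⟩ : ∃ q, φ.d q ≠ 0 := Function.ne_iff.1 hc
  set y₀ := extChartAt (𝓡 n) q q with hy₀
  have htgt : (extChartAt (𝓡 n) q).target ∈ 𝓝 y₀ := extChartAt_target_mem_nhds q
  have hy : y₀ ∈ (extChartAt (𝓡 n) q).target := mem_extChartAt_target q
  have hd : extDeriv (φ.inChart q) y₀ ≠ 0 := by
    intro h0
    apply hq
    ext v
    change extDeriv (φ.inChart q) y₀ _ = 0
    rw [h0]
    rfl
  have hφd : DifferentiableAt ℝ (φ.inChart q) y₀ :=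
    ((hφ q).contDiffAt htgt).differentiableAt (by simp)
  obtain ⟨α, hα, hα'⟩ := exists_isSmooth_toForm_const q 0 (1 : Λ)
  have hone : (1 : Λ) ∈ ⋀[ℝ]^0 (𝔼 →L[ℝ] ℝ) := SetLike.GradedOne.one_mem
  have k : (bracket F t φ α α).inChart q =ᶠ[𝓝 y₀] fun y =>
      toForm 1 ((F 0 0 * t) • ι (covector (φ.inChart q y))) := by
    filter_upwards [htgt, hα'.eventuallyEq_nhds] with y hy h1
    rw [inChart_bracket hy (fun _ => hone) (fun _ => hone) h1 h1
      (fun _ => rfl) (differentiableAt_const _), extDeriv_const, smul_zero]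
    exact (zero_add _).trans (by rw [mul_one, one_mul])
  have j : (bracket F t φ (bracket F t φ α α) α).inChart q y₀ =
      -((F 0 0 * t) • extDeriv (φ.inChart q) y₀) := by
    rw [inChart_bracket (a := 0 + 0 + 1) hy (fun _ => Submodule.smul_mem _ _ (by simp))
      (fun _ => hone) k hα' (Z := (F 0 0 * t) • φ.inChart q)
      (fun z => by
        rw [mul_one, map_smul]
        exact congrArg _ (toForm_ι_covector _)) (hφd.const_smul _), extDeriv_smul]
    simp
  have h1 := congrArg (fun η => inChart η q y₀) (h 0 0 0 α α α hα hα hα)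
  change (-1 : ℝ) ^ 1 • (bracket F t φ (bracket F t φ α α) α).inChart q y₀ +
    (-1 : ℝ) ^ 1 • (bracket F t φ (bracket F t φ α α) α).inChart q y₀ +
    (-1 : ℝ) ^ 1 • (bracket F t φ (bracket F t φ α α) α).inChart q y₀ = 0 at h1
  rw [j, pow_one, smul_neg, neg_one_smul, neg_neg, ← add_smul, ← add_smul] at h1
  have h2 := (smul_eq_zero.1 h1).resolve_right hd
  have h3 : F 0 0 * t = 0 := by linarith
  exact (mul_eq_zero.1 h3).resolve_right ht

/-! ### Equations for the structure function -/

theorem covector_inChart_ne_zero {φ : DForm n M 1} {q : M} (hq : φ q ≠ 0) :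
    covector (φ.inChart q (extChartAt (𝓡 n) q q)) ≠ 0 := by
  intro h
  apply hq
  apply eq_zero_of_inChart_eq_zero
  rw [← toForm_ι_covector (φ.inChart q (extChartAt (𝓡 n) q q)), h, map_zero, map_zero]

theorem SuperSymmetric.symm [T2Space M] {F : ℕ → ℕ → ℝ} {t : ℝ} (ht : t ≠ 0) {φ : DForm n M 1}
    (hφ : φ ≠ 0) (h : SuperSymmetric F t φ) {a b : ℕ} (hab : a + b + 1 ≤ n) :
    F a b = F b a := by
  obtain ⟨q, hq⟩ : ∃ q, φ q ≠ 0 := Function.ne_iff.1 hφ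
  obtain ⟨e, he⟩ := exists_toForm_ι_mul_ιMulti_ne_zero (covector_inChart_ne_zero hq) (a + b)
    (by rw [finrank_euclideanSpace_fin]; omega)
  rw [← Fin.append_castAdd_natAdd (f := e), ← ExteriorAlgebra.ιMulti_mul_ιMulti] at he
  set x := ExteriorAlgebra.ιMulti ℝ a fun i => e (Fin.castAdd b i)
  set z := ExteriorAlgebra.ιMulti ℝ b fun i => e (Fin.natAdd a i)
  have hxm : x ∈ ⋀[ℝ]^a (𝔼 →L[ℝ] ℝ) := (exteriorPower.ιMulti ℝ a _).2
  have hzm : z ∈ ⋀[ℝ]^b (𝔼 →L[ℝ] ℝ) := (exteriorPower.ιMulti ℝ b _).2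
  have h1 := h.relation q hxm hzm
  rw [mul_ι_of_mem hxm, smul_mul_assoc, smul_smul, map_smul] at h1
  rw [← mul_assoc] at he
  have h2 := (smul_eq_zero.1 h1).resolve_right he
  have h3 : ((-1 : ℝ) ^ a) ≠ 0 := pow_ne_zero _ (by norm_num)
  have h4 : F a b - F b a = 0 := by simpa [ht, h3] using h2
  linarith

theorem SuperJacobi.recurrence [T2Space M] {F : ℕ → ℕ → ℝ} {t : ℝ} (ht : t ≠ 0) {φ : DForm n M 1}
    (hφs : φ.IsSmooth) (hφ : φ ≠ 0) (h : SuperJacobi F t φ) {b c : ℕ} (hbc : b + c + 2 ≤ n) :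
    F 0 b - F (b + 1) c + F b c - F (b + c + 1) 0 + F c 0 = 0 := by
  obtain ⟨q, hq⟩ : ∃ q, φ q ≠ 0 := Function.ne_iff.1 hφ
  obtain ⟨e, he⟩ := exists_toForm_ι_mul_ιMulti_ne_zero (covector_inChart_ne_zero hq) (b + c + 1)
    (by rw [finrank_euclideanSpace_fin]; omega)
  rw [ExteriorAlgebra.ιMulti_succ_apply, ← Fin.append_castAdd_natAdd (f := Matrix.vecTail e),
    ← ExteriorAlgebra.ιMulti_mul_ιMulti, ← mul_assoc, ← mul_assoc] at he
  have h1 := h.relation hφs q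
    (exteriorPower.ιMulti ℝ b fun i => Matrix.vecTail e (Fin.castAdd c i)).2
    (exteriorPower.ιMulti ℝ c fun i => Matrix.vecTail e (Fin.natAdd b i)).2 (e 0)
  rw [map_smul] at h1
  have h2 := (smul_eq_zero.1 h1).resolve_right he
  exact (mul_eq_zero.1 h2).resolve_right ht

/-- Solution of the recurrence: `c = 0` determines `F (b + 1) 0` from `F b 0`, and the general case
then gives `F (b + 1) c = F b c + F 0 0 / 2`. -/
theorem eq_mul_add_of_recurrence {F : ℕ → ℕ → ℝ} {n : ℕ}
    (hs : ∀ a b, a + b + 1 ≤ n → F a b = F b a)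
    (hr : ∀ b c, b + c + 2 ≤ n → F 0 b - F (b + 1) c + F b c - F (b + c + 1) 0 + F c 0 = 0)
    {a b : ℕ} (hab : a + b + 1 ≤ n) : F a b = F 0 0 / 2 * (a + b + 2) := by
  have h0 : ∀ a, a + 1 ≤ n → F a 0 = F 0 0 / 2 * (a + 2) := by
    intro a
    induction a with
    | zero => intro _; push_cast; ring
    | succ a ih =>
      intro ha
      have h1 := hr a 0 (by omega)
      have h2 := ih (by omega)
      have h3 := hs 0 a (by omega)
      rw [Nat.add_zero] at h1
      push_cast
      linarith
  induction a with
  | zero =>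
    rw [hs 0 b hab, h0 b (by omega)]
    push_cast
    ring
  | succ a ih =>
    have h1 := hr a b (by omega)
    have h2 := ih (by omega)
    have h3 := hs 0 a (by omega)
    rw [h3, h0 a (by omega), h0 (a + b + 1) (by omega), h0 b (by omega), h2] at h1
    push_cast at h1 ⊢
    linarith

end DForm

end

theorem mainTheorem3 (n : ℕ) (M : Type*) [TopologicalSpace M] [T2Space M]
    [ChartedSpace (EuclideanSpace ℝ (Fin n)) M] [IsManifold (𝓡 n) ∞ M]
    (φ : DForm n M 1) (hφ : φ.IsSmooth) (hφ0 : φ ≠ 0) (t : ℝ) (ht : t ≠ 0) (F : ℕ → ℕ → ℝ) :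
    (DForm.SuperSymmetric F t φ → ∀ a b : ℕ, a + b + 1 ≤ n → F a b = F b a) ∧
    (DForm.SuperSymmetric F t φ → DForm.SuperJacobi F t φ → ¬ φ.IsClosed →
      ∀ a b : ℕ, a + b + 1 ≤ n → F a b = 0) ∧
    (DForm.SuperSymmetric F t φ → DForm.SuperJacobi F t φ → φ.IsClosed →
      ∃ κ : ℝ, ∀ a b : ℕ, a + b + 1 ≤ n → F a b = κ * (a + b + 2)) := by
  have key : DForm.SuperSymmetric F t φ → DForm.SuperJacobi F t φ →
      ∀ a b : ℕ, a + b + 1 ≤ n → F a b = F 0 0 / 2 * (a + b + 2) := fun hs hj a b hab =>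
    DForm.eq_mul_add_of_recurrence (fun a b => hs.symm ht hφ0)
      (fun b c => hj.recurrence ht hφ hφ0) hab
  refine ⟨fun hs a b => hs.symm ht hφ0, fun hs hj hc a b hab => ?_, fun hs hj _ =>
    ⟨F 0 0 / 2, key hs hj⟩⟩
  rw [key hs hj a b hab, hj.apply_zero_zero ht hφ hc, zero_div, zero_mul]
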